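/- \textbf{Setting.} Let $K\ge 2$ agents $\mathcal K=\{1,\dots,K\}$ share $N$ goods $\mathcal N=\{1,\dots,N\}$. Agent $j$ has a family $\mathcal A_j\subseteq 2^{\mathcal N}$ of feasible bundles with $\emptyset\in\mathcal A_j$. An allocation is a map $\phi$ on $\mathcal K$ with $\phi(j)\in\mathcal A_j$ for all $j$ and $\phi(i)\cap\phi(j)=\emptyset$ for $i\ne j$; $\mathcal M$ is the set of allocations. Agent $j$ has a reward function $r^j:\mathbb R^N\times\mathcal A_j\to\mathbb R$, and $\bm\mu\in\mathbb R^N$ is the unknown vector of true qualities. Observing good $i$ in round $t$ yields $X_i(t)=\mu_i+\epsilon_i(t)$, where the noise vectors $(\epsilon_i(t))_{i\in\mathcal N}$ are independent and identically distributed over $t$ and each $\epsilon_i(t)$ is $\sigma^2$-sub-Gaussian, i.e. $\mathbb E\,e^{\lambda\epsilon_i(t)}\le e^{\lambda^2\sigma^2/2}$ for all $\lambda\in\mathbb R$ (in particular centred), with $\sigma>0$. \textbf{Algorithm (Dueling Max-Min ULCB), with parameter $\alpha>2$.} Let $T_i(t)$ be the number of observations of good $i$ in rounds $1,\dots,t$.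 In round $t\le N$ good $t$ is observed, and the allocation $\phi_t\in\mathcal M$ is arbitrary (fixed in advance). In round $t>N$, let $\hat\mu_i(t)$ be the average of the observations of good $i$ made before round $t$ and put \[\bar\nu_i(t)=\hat\mu_i(t)+\sqrt{\tfrac{1}{T_i(t-1)}\,2\sigma^2\log t^{\alpha}},\qquad \underline\nu_i(t)=\hat\mu_i(t)-\sqrt{\tfrac{1}{T_i(t-1)}\,2\sigma^2\log t^{\alpha}} .\] A first oracle, applied to $\bar{\bm\nu}(t)$, returns an allocation $\phi_t\in\arg\max_{\phi\in\mathcal M}\min_{j}r^j(\bar{\bm\nu}(t);\phi(j))$; a second oracle, applied to $\underline{\bm\nu}(t)$ and $\phi_t$, returns an agent $j_t\in\arg\min_j r^j(\underline{\bm\nu}(t);\phi_t(j))$; all goods in $\phi_t(j_t)$ are then observed. Ties are broken in any measurable way. The regret is \[R_T=\mathbb E\Big[\sum_{t=1}^T\Big(\max_{\phi\in\mathcal M}\min_{j\in\mathcal K}r^j(\bm\mu;\phi(j))-\min_{j\in\mathcal K}r^j(\bm\mu;\phi_t(j))\Big)\Big].\] \textbf{Proposition.} Suppose that, for some $\Delta_{\max}$,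 \[\big|r^j(\bm\mu;\phi(j))-r^i(\bm\mu;\phi(i))\big|\le\Delta_{\max}\qquad\text{for all }\phi\in\mathcal M\text{ and all }i\ne j\text{ in }\mathcal K,\] and that there is a constant $c>0$ such that for every agent $j$, every $S\in\mathcal A_j$ and all $\mathbf x,\mathbf y\in\mathbb R^N$ one has $|r^j(\mathbf x;S)-r^j(\mathbf y;S)|\le c\sum_{i\in S}|x_i-y_i|$, and $r^j(\mathbf x;S)\le r^j(\mathbf y;S)$ whenever $x_i\le y_i$ for all $i\in S$. Then for every horizon $T>N$ the regret of the algorithm is well defined (the sum inside the expectation is integrable) and satisfies \[R_T\le 3\,\Delta_{\max}\,N\Big[\frac{\alpha-1}{\alpha-2}+2\Big]+4.5^{2/3}\Big(\Delta_{\max}\,N^3\,c^2\,\big(\sqrt{2\alpha}+2\big)^2\sigma^2\log T\Big)^{1/3}T^{2/3}.\] -/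

import Mathlib

open MeasureTheory ProbabilityTheory

noncomputable section

namespace FairBundle

variable {K N : ℕ}

/-- The set `𝓜` of allocations: every agent `j` receives a bundle that is feasible for `j`, and
the bundles of distinct agents are disjoint. -/
def allocations (A : Fin K → Set (Finset (Fin N))) : Set (Fin K → Finset (Fin N)) :=
  {φ | (∀ j, φ j ∈ A j) ∧ ∀ i j, i ≠ j → Disjoint (φ i) (φ j)}

/-- The least reward `min_j r^j(x; φ(j))` that an agent receives under `φ` at the quality
vector `x`. -/
def minReward (r : Fin K → (Fin N → ℝ) → Finset (Fin N) → ℝ) (x : Fin N → ℝ)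
    (φ : Fin K → Finset (Fin N)) : ℝ :=
  ⨅ j, r j x (φ j)

/-- The max-min objective `max_{φ ∈ 𝓜} min_j r^j(x; φ(j))` (a maximum over a finite set). -/
def maxMin (A : Fin K → Set (Finset (Fin N)))
    (r : Fin K → (Fin N → ℝ) → Finset (Fin N) → ℝ) (x : Fin N → ℝ) : ℝ :=
  sSup (minReward r x '' allocations A)

/-- The Lipschitz and monotone reward assumption with constant `c`. -/
def LipschitzMonotone (A : Fin K → Set (Finset (Fin N)))
    (r : Fin K → (Fin N → ℝ) → Finset (Fin N) → ℝ) (c : ℝ) : Prop :=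
  ∀ j, ∀ S ∈ A j, ∀ x y : Fin N → ℝ,
    |r j x S - r j y S| ≤ c * ∑ i ∈ S, |x i - y i| ∧
      ((∀ i ∈ S, x i ≤ y i) → r j x S ≤ r j y S)

/-- `O₁` is a (measurable) max-min oracle: for every quality vector `x` it returns an allocation
that maximizes the least reward at `x`. Ties may be broken in any measurable way. -/
def IsMaxMinOracle (A : Fin K → Set (Finset (Fin N)))
    (r : Fin K → (Fin N → ℝ) → Finset (Fin N) → ℝ)
    (O₁ : (Fin N → ℝ) → Fin K → Finset (Fin N)) : Prop :=
  (∀ x, O₁ x ∈ allocations A ∧ ∀ φ ∈ allocations A, minReward r x φ ≤ minReward r x (O₁ x)) ∧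
    ∀ φ, MeasurableSet {x | O₁ x = φ}

/-- `O₂` is a (measurable) least-reward oracle: for every quality vector `x` and allocation `φ`
it returns an agent whose reward `r^j(x; φ(j))` is smallest. -/
def IsMinAgentOracle (A : Fin K → Set (Finset (Fin N)))
    (r : Fin K → (Fin N → ℝ) → Finset (Fin N) → ℝ)
    (O₂ : (Fin N → ℝ) → (Fin K → Finset (Fin N)) → Fin K) : Prop :=
  ∀ φ ∈ allocations A,
    (∀ x j, r (O₂ x φ) x (φ (O₂ x φ)) ≤ r j x (φ j)) ∧
      ∀ j, MeasurableSet {x | O₂ x φ = j}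

/-- What the algorithm has recorded so far: for each item the number of times it was observed and
the sum of the signals observed. -/
structure Record (N : ℕ) where
  count : Fin N → ℕ
  total : Fin N → ℝ

/-- The empirical mean of the signals collected for item `i`. -/
def Record.mean (s : Record N) (i : Fin N) : ℝ := s.total i / s.count i

/-- The confidence width `√((1 / Tᵢ(t-1)) · 2 σ² log t^α)` in round `t`, where `s` is the record
after round `t - 1`. -/
def Record.width (σ α : ℝ) (t : ℕ) (s : Record N) (i : Fin N) : ℝ :=
  √(1 / (s.count i : ℝ) * (2 * σ ^ 2 * Real.log ((t : ℝ) ^ α)))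

/-- The vector of upper confidence bounds in round `t`. -/
def Record.ucb (σ α : ℝ) (t : ℕ) (s : Record N) (i : Fin N) : ℝ := s.mean i + s.width σ α t i

/-- The vector of lower confidence bounds in round `t`. -/
def Record.lcb (σ α : ℝ) (t : ℕ) (s : Record N) (i : Fin N) : ℝ := s.mean i - s.width σ α t i

/-- The allocation made in round `t` when `s` is the record after round `t - 1`: a preset
allocation `φ₀ t` in the initial rounds `1, …, N`, afterwards the max-min allocation for the upper
confidence bounds. -/
def chosenAllocation (σ α : ℝ) (O₁ : (Fin N → ℝ) → Fin K → Finset (Fin N))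
    (φ₀ : ℕ → Fin K → Finset (Fin N)) (t : ℕ) (s : Record N) : Fin K → Finset (Fin N) :=
  if t ≤ N then φ₀ t else O₁ (s.ucb σ α t)

/-- The set of items observed in round `t` when `s` is the record after round `t - 1`: the `t`-th
item in the initial rounds `t = 1, …, N`, afterwards the bundle that the chosen allocation gives
to the agent with the least reward at the lower confidence bounds. -/
def observedItems (σ α : ℝ) (O₁ : (Fin N → ℝ) → Fin K → Finset (Fin N))
    (O₂ : (Fin N → ℝ) → (Fin K → Finset (Fin N)) → Fin K)
    (φ₀ : ℕ → Fin K → Finset (Fin N)) (t : ℕ) (s : Record N) : Finset (Fin N) :=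
  if t ≤ N then Finset.univ.filter (fun i : Fin N => i.val + 1 = t)
  else
    chosenAllocation σ α O₁ φ₀ t s (O₂ (s.lcb σ α t) (chosenAllocation σ α O₁ φ₀ t s))

/-- The record of the Dueling Max-Min ULCB algorithm after round `t`, when `X t i` is the signal
on the quality of item `i` in round `t` (used only if `i` is observed in that round). -/
def ulcbRecord (σ α : ℝ) (O₁ : (Fin N → ℝ) → Fin K → Finset (Fin N))
    (O₂ : (Fin N → ℝ) → (Fin K → Finset (Fin N)) → Fin K)
    (φ₀ : ℕ → Fin K → Finset (Fin N)) (X : ℕ → Fin N → ℝ) : ℕ → Record N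
  | 0 => ⟨fun _ => 0, fun _ => 0⟩
  | t + 1 =>
    let s := ulcbRecord σ α O₁ O₂ φ₀ X t
    let S := observedItems σ α O₁ O₂ φ₀ (t + 1) s
    ⟨fun i => if i ∈ S then s.count i + 1 else s.count i,
      fun i => if i ∈ S then s.total i + X (t + 1) i else s.total i⟩

/-- The allocation `φ_t` made by the Dueling Max-Min ULCB algorithm in round `t ≥ 1`. -/
def ulcbAllocation (σ α : ℝ) (O₁ : (Fin N → ℝ) → Fin K → Finset (Fin N))
    (O₂ : (Fin N → ℝ) → (Fin K → Finset (Fin N)) → Fin K)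
    (φ₀ : ℕ → Fin K → Finset (Fin N)) (X : ℕ → Fin N → ℝ) (t : ℕ) : Fin K → Finset (Fin N) :=
  chosenAllocation σ α O₁ φ₀ t (ulcbRecord σ α O₁ O₂ φ₀ X (t - 1))

/-- The sum over rounds `1, …, T` of the shortfall of the least true reward under the allocation
made by the algorithm from the max-min objective; its expectation is the regret `R_T`. -/
def cumulativeShortfall (A : Fin K → Set (Finset (Fin N)))
    (r : Fin K → (Fin N → ℝ) → Finset (Fin N) → ℝ) (μ : Fin N → ℝ) (σ α : ℝ)
    (O₁ : (Fin N → ℝ) → Fin K → Finset (Fin N))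
    (O₂ : (Fin N → ℝ) → (Fin K → Finset (Fin N)) → Fin K)
    (φ₀ : ℕ → Fin K → Finset (Fin N)) (X : ℕ → Fin N → ℝ) (T : ℕ) : ℝ :=
  ∑ t ∈ Finset.Icc 1 T,
    (maxMin A r μ - minReward r μ (ulcbAllocation σ α O₁ O₂ φ₀ X t))

end FairBundle

end

noncomputable section

namespace FairBundle

variable {K N : ℕ}

/-! Fix a round after the first `N`. If all confidence intervals are valid, optimism bounds the
max-min value by the least reward of the chosen allocation at the upper bounds. The agent selected
at the lower bounds has a lower-bound reward below every true reward, so the loss is at most `c`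
times the interval lengths summed over that agent's bundle alone, which is exactly the bundle
observed. If an upper bound fails, comparison with the empty allocation, whose reward does not
depend on the qualities, costs an extra `Δ`. If a lower bound fails, the trivial loss bound `2 Δ` is
used. Hence the factor `3 = 1 + 2` (`round_gap_le`).

Each one-sided failure has probability at most `N t ^ (-(α - 1))`, from an exponential
supermartingale for the noise collected on one item and a union over its random count
(`lintegral_exp_record_le_one`, `measure_deviates_le`). These probabilities are summable because `α
> 2`.

The widths, truncated at `2 Δ`, are regrouped by item and count (`sum_observed_eq`). Each item then
contributes at most `∑ min M (b / √k)`, and the cube of this sum is at most `27/16 * M b² T²`. This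
is the source of the cube root and of `T ^ (2/3)`. -/

/-! ### Least rewards, and the loss of one allocation -/

lemma minReward_le (r : Fin K → (Fin N → ℝ) → Finset (Fin N) → ℝ) (x : Fin N → ℝ)
    (φ : Fin K → Finset (Fin N)) (j : Fin K) : minReward r x φ ≤ r j x (φ j) :=
  ciInf_le (Set.finite_range _).bddBelow j

lemma le_minReward [Nonempty (Fin K)] {r : Fin K → (Fin N → ℝ) → Finset (Fin N) → ℝ}
    {x : Fin N → ℝ} {φ : Fin K → Finset (Fin N)} {m : ℝ} (h : ∀ j, m ≤ r j x (φ j)) :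
    m ≤ minReward r x φ :=
  le_ciInf h

lemma empty_mem_allocations {A : Fin K → Set (Finset (Fin N))} (hA : ∀ j, ∅ ∈ A j) :
    (fun _ => ∅) ∈ allocations A :=
  ⟨hA, fun _ _ _ => Finset.disjoint_empty_left _⟩

lemma update_empty_mem_allocations {A : Fin K → Set (Finset (Fin N))} (hA : ∀ j, ∅ ∈ A j)
    {j : Fin K} {S : Finset (Fin N)} (hS : S ∈ A j) :
    Function.update (fun _ => ∅) j S ∈ allocations A := by
  refine ⟨fun k => ?_, fun k l hkl => ?_⟩
  · by_cases h : k = j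
    · subst h; simpa using hS
    · simpa [h] using hA k
  · by_cases h : k = j
    · have : l ≠ j := fun h' => hkl (h.trans h'.symm)
      simp [this]
    · simp [h]

lemma exists_maxMin_eq {A : Fin K → Set (Finset (Fin N))} (hA : ∀ j, ∅ ∈ A j)
    (r : Fin K → (Fin N → ℝ) → Finset (Fin N) → ℝ) (x : Fin N → ℝ) :
    ∃ φ ∈ allocations A, minReward r x φ = maxMin A r x :=
  Set.Nonempty.csSup_mem (Set.Nonempty.image _ ⟨_, empty_mem_allocations hA⟩)
    ((Set.toFinite _).image _)

lemma LipschitzMonotone.minReward_mono [Nonempty (Fin K)] {A : Fin K → Set (Finset (Fin N))}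
    {r : Fin K → (Fin N → ℝ) → Finset (Fin N) → ℝ} {c : ℝ} (hr : LipschitzMonotone A r c)
    {φ : Fin K → Finset (Fin N)} (hφ : φ ∈ allocations A) {x y : Fin N → ℝ}
    (hxy : ∀ i, x i ≤ y i) : minReward r x φ ≤ minReward r y φ :=
  le_minReward fun j => (minReward_le r x φ j).trans
    ((hr j (φ j) (hφ.1 j) x y).2 fun i _ => hxy i)

/-- On the empty bundle the monotonicity hypothesis is vacuous in both directions. -/
lemma LipschitzMonotone.minReward_empty {A : Fin K → Set (Finset (Fin N))}
    {r : Fin K → (Fin N → ℝ) → Finset (Fin N) → ℝ} {c : ℝ} (hr : LipschitzMonotone A r c)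
    (hA : ∀ j, ∅ ∈ A j) (x y : Fin N → ℝ) :
    minReward r x (fun _ => ∅) = minReward r y (fun _ => ∅) := by
  have : ∀ j, r j x ∅ = r j y ∅ := fun j => le_antisymm
    ((hr j ∅ (hA j) x y).2 (by simp)) ((hr j ∅ (hA j) y x).2 (by simp))
  simp [minReward, this]

/-- Within-allocation reward differences are at most `Δ`. -/
def RewardSpread (A : Fin K → Set (Finset (Fin N)))
    (r : Fin K → (Fin N → ℝ) → Finset (Fin N) → ℝ) (μ : Fin N → ℝ) (Δ : ℝ) : Prop :=
  ∀ φ ∈ allocations A, ∀ i j : Fin K, i ≠ j → |r j μ (φ j) - r i μ (φ i)| ≤ Δ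

section Spread

variable {A : Fin K → Set (Finset (Fin N))} {r : Fin K → (Fin N → ℝ) → Finset (Fin N) → ℝ}
  {μ : Fin N → ℝ} {Δ : ℝ}

/-- Apply the spread to the allocation that gives `S` to `j` and nothing to anyone else. The spread
only compares agents within one allocation, so the empty bundle serves as the bridge between two
allocations. -/
lemma RewardSpread.abs_sub_empty_le (hΔ : RewardSpread A r μ Δ) (hA : ∀ j, ∅ ∈ A j)
    {i j : Fin K} (hij : i ≠ j) {S : Finset (Fin N)} (hS : S ∈ A j) :
    |r j μ S - r i μ ∅| ≤ Δ := by
  simpa [hij] using hΔ _ (update_empty_mem_allocations hA hS) i j hij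

variable [Nontrivial (Fin K)]

lemma RewardSpread.nonneg (hΔ : RewardSpread A r μ Δ) (hA : ∀ j, ∅ ∈ A j) : 0 ≤ Δ := by
  obtain ⟨i, j, hij⟩ := exists_pair_ne (Fin K)
  exact (abs_nonneg _).trans (hΔ _ (empty_mem_allocations hA) i j hij)

lemma RewardSpread.maxMin_le (hΔ : RewardSpread A r μ Δ) (hA : ∀ j, ∅ ∈ A j) :
    maxMin A r μ ≤ minReward r μ (fun _ => ∅) + Δ := by
  obtain ⟨φ, hφ, h⟩ := exists_maxMin_eq hA r μ
  rw [← h, ← sub_le_iff_le_add]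
  refine le_minReward fun i => ?_
  obtain ⟨j, hj⟩ := exists_ne i
  have h1 := abs_le.1 (hΔ.abs_sub_empty_le hA hj.symm (hφ.1 j))
  linarith [minReward_le r μ φ j, h1.2]

lemma RewardSpread.le_minReward_add (hΔ : RewardSpread A r μ Δ) (hA : ∀ j, ∅ ∈ A j)
    {φ : Fin K → Finset (Fin N)} (hφ : φ ∈ allocations A) :
    minReward r μ (fun _ => ∅) ≤ minReward r μ φ + Δ := by
  rw [← sub_le_iff_le_add]
  refine le_minReward fun j => ?_
  obtain ⟨i, hi⟩ := exists_ne j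
  have h1 := abs_le.1 (hΔ.abs_sub_empty_le hA hi (hφ.1 j))
  linarith [minReward_le r μ (fun _ => ∅) i, h1.1]

/-- The loss of any single allocation is at most `2 Δ`. -/
lemma RewardSpread.gap_le (hΔ : RewardSpread A r μ Δ) (hA : ∀ j, ∅ ∈ A j)
    {φ : Fin K → Finset (Fin N)} (hφ : φ ∈ allocations A) :
    maxMin A r μ - minReward r μ φ ≤ 2 * Δ := by
  linarith [hΔ.maxMin_le hA, hΔ.le_minReward_add hA hφ]

variable {c : ℝ} {hi lo : Fin N → ℝ} {φ : Fin K → Finset (Fin N)} {j : Fin K}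

/-- Agent `j` attains the minimum at `lo`, so its reward there is below the least true reward;
passing from `lo` to `hi` for this one agent is a Lipschitz step over `φ j` only. -/
lemma minReward_hi_le (hr : LipschitzMonotone A r c) (hφ : φ ∈ allocations A)
    (hj : ∀ i, r j lo (φ j) ≤ r i lo (φ i)) (hlo : ∀ i, lo i ≤ μ i) :
    minReward r hi φ ≤ minReward r μ φ + c * ∑ i ∈ φ j, |hi i - lo i| := by
  have h1 : r j lo (φ j) ≤ minReward r μ φ :=
    (le_minReward hj).trans (hr.minReward_mono hφ hlo)
  have h2 := (abs_le.1 (hr j (φ j) (hφ.1 j) hi lo).1).2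
  linarith [minReward_le r hi φ j]

lemma gap_le_of_mem_interval (hr : LipschitzMonotone A r c) (hA : ∀ j, ∅ ∈ A j)
    (hφ : φ ∈ allocations A) (hmax : ∀ ψ ∈ allocations A, minReward r hi ψ ≤ minReward r hi φ)
    (hj : ∀ i, r j lo (φ j) ≤ r i lo (φ i)) (hlo : ∀ i, lo i ≤ μ i) (hhi : ∀ i, μ i ≤ hi i) :
    maxMin A r μ - minReward r μ φ ≤ c * ∑ i ∈ φ j, |hi i - lo i| := by
  obtain ⟨ψ, hψ, h⟩ := exists_maxMin_eq hA r μ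
  linarith [hr.minReward_mono hψ hhi, hmax ψ hψ,
    minReward_hi_le (hi := hi) hr hφ hj hlo]

/-- If only the lower bounds are valid, then comparison with the empty allocation still bounds the
loss. -/
lemma gap_le_of_lower (hr : LipschitzMonotone A r c) (hA : ∀ j, ∅ ∈ A j)
    (hΔ : RewardSpread A r μ Δ)
    (hφ : φ ∈ allocations A) (hmax : ∀ ψ ∈ allocations A, minReward r hi ψ ≤ minReward r hi φ)
    (hj : ∀ i, r j lo (φ j) ≤ r i lo (φ i)) (hlo : ∀ i, lo i ≤ μ i) :
    maxMin A r μ - minReward r μ φ ≤ Δ + c * ∑ i ∈ φ j, |hi i - lo i| := by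
  linarith [hΔ.maxMin_le hA, hmax _ (empty_mem_allocations hA), hr.minReward_empty hA μ hi,
    minReward_hi_le (hi := hi) hr hφ hj hlo]

end Spread

/-! ### Truncated sums and power sums -/

lemma min_sum_le_sum_min {ι : Type*} (s : Finset ι) {M : ℝ} (hM : 0 ≤ M) {f : ι → ℝ}
    (hf : ∀ i ∈ s, 0 ≤ f i) : min M (∑ i ∈ s, f i) ≤ ∑ i ∈ s, min M (f i) := by
  classical
  induction s using Finset.induction_on with
  | empty => simp
  | insert a s ha ih =>
    rw [Finset.sum_insert ha, Finset.sum_insert ha]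
    have h1 := ih fun i hi => hf i (Finset.mem_insert_of_mem hi)
    have h2 := hf a (Finset.mem_insert_self a s)
    have h3 : 0 ≤ ∑ i ∈ s, f i := Finset.sum_nonneg fun i hi => hf i (Finset.mem_insert_of_mem hi)
    refine le_trans ?_ (add_le_add_right h1 _)
    rcases min_cases M (f a) with h | h <;> rcases min_cases M (∑ i ∈ s, f i) with h' | h' <;>
      rcases min_cases M (f a + ∑ i ∈ s, f i) with h'' | h'' <;> linarith

/-- The truncated sum is at most the corresponding integral. -/
lemma sum_min_div_sqrt_le {M b : ℝ} (hM : 0 < M) (hb : 0 ≤ b) (n : ℕ) :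
    ∑ k ∈ Finset.range (n + 1), min M (b / √(k : ℝ)) ≤
      if b ≤ M * √(n : ℝ) then 2 * b * √(n : ℝ) - b ^ 2 / M else M * n := by
  induction n with
  | zero =>
    -- The term `k = 0` vanishes, since `b / √0 = 0`.
    rcases hb.eq_or_lt with h | h
    · simp [← h, hM.le]
    · simp [h.not_ge, hM.le]
  | succ n ih =>
    rw [Finset.sum_range_succ]
    have hs : (0 : ℝ) < √((n + 1 : ℕ) : ℝ) := Real.sqrt_pos.2 (by positivity)
    have hs2 : √((n + 1 : ℕ) : ℝ) ^ 2 = (n : ℝ) + 1 := by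
      rw [Real.sq_sqrt (by positivity)]; push_cast; ring
    have hq2 : √(n : ℝ) ^ 2 = n := Real.sq_sqrt (by positivity)
    have hq : (0 : ℝ) ≤ √(n : ℝ) := Real.sqrt_nonneg _
    have hqs : √(n : ℝ) ≤ √((n + 1 : ℕ) : ℝ) := Real.sqrt_le_sqrt (by simp)
    generalize √((n + 1 : ℕ) : ℝ) = s at *
    generalize √(n : ℝ) = q at *
    have hmin1 := min_le_left M (b / s)
    have hmin2 := min_le_right M (b / s)
    by_cases h : b ≤ M * q
    · rw [if_pos h] at ih
      rw [if_pos (h.trans (by gcongr))]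
      -- From `s² - q² = 1`: `2 s (s - q) = 1 + (s - q)²`.
      have : b / s ≤ 2 * b * s - 2 * b * q := by
        rw [div_le_iff₀ hs]
        nlinarith [mul_nonneg hb (sq_nonneg (s - q))]
      linarith
    · rw [if_neg h] at ih
      push Not at h
      by_cases h' : b ≤ M * s
      · rw [if_pos h']
        -- The step on which the integrand leaves its cap `M`. With `d = M s - b ≥ 0`, the claim
        -- becomes `d (M / s - d) ≥ 0`.
        have h1 : M * s - b ≤ M / s := by
          rw [le_div_iff₀ hs]
          nlinarith [mul_le_mul_of_nonneg_right h.le hq, mul_le_mul_of_nonneg_left hqs hb]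
        have h2 : (M * s - b) * (M * s - b) ≤ (M / s) * (M * s - b) :=
          mul_le_mul_of_nonneg_right h1 (by linarith)
        have h3 : M * n + b / s ≤ 2 * b * s - b ^ 2 / M := by
          have e : 2 * b * s - b ^ 2 / M - (M * n + b / s) =
              ((M / s) * (M * s - b) - (M * s - b) * (M * s - b)) / M := by
            have : (n : ℝ) = s ^ 2 - 1 := by linarith
            rw [this]; field_simp; ring
          have : 0 ≤ ((M / s) * (M * s - b) - (M * s - b) * (M * s - b)) / M :=
            div_nonneg (by linarith) hM.le
          linarith
        linarith
      · rw [if_neg h']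
        push_cast
        linarith

/-- Multiplying the bound `M n` by the square of `2 b √n` would give the constant `4`, too large for
the final `4.5 ^ (2/3)` when `α` is large. Cubing the exact integral gives `27/16`. -/
lemma sum_min_div_sqrt_pow_three_le {M b : ℝ} (hM : 0 ≤ M) (hb : 0 ≤ b) (n : ℕ) :
    (∑ k ∈ Finset.range (n + 1), min M (b / √(k : ℝ))) ^ 3 ≤ 27 / 16 * (M * b ^ 2 * n ^ 2) := by
  have h0 : 0 ≤ ∑ k ∈ Finset.range (n + 1), min M (b / √(k : ℝ)) :=
    Finset.sum_nonneg fun k _ => le_min hM (by positivity)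
  rcases hM.eq_or_lt with h | hM
  · subst h
    have : ∀ k : ℕ, min 0 (b / √(k : ℝ)) = 0 := fun k => min_eq_left (by positivity)
    simp [this]
  have h1 := sum_min_div_sqrt_le hM hb n
  have hq2 : √(n : ℝ) ^ 2 = n := Real.sq_sqrt (by positivity)
  have hq : (0 : ℝ) ≤ √(n : ℝ) := Real.sqrt_nonneg _
  refine (pow_le_pow_left₀ h0 h1 3).trans ?_
  generalize √(n : ℝ) = q at *
  rw [← hq2]
  split_ifs with h
  -- Equality holds at `M q = 2 b`, hence the squared factor; the remaining quadratic is
  -- nonnegative.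
  · have e : 27 / 16 * (M * b ^ 2 * (q ^ 2) ^ 2) - (2 * b * q - b ^ 2 / M) ^ 3 =
        b ^ 2 * (M * q - 2 * b) ^ 2 *
          (27 * (M * q) ^ 2 - 20 * (M * q) * b + 4 * b ^ 2) / (16 * M ^ 3) := by
      field_simp; ring
    have : 0 ≤ 27 * (M * q) ^ 2 - 20 * (M * q) * b + 4 * b ^ 2 := by
      nlinarith [sq_nonneg (5 * (M * q) - 2 * b), sq_nonneg (M * q)]
    have : 0 ≤ 27 / 16 * (M * b ^ 2 * (q ^ 2) ^ 2) - (2 * b * q - b ^ 2 / M) ^ 3 := by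
      rw [e]; positivity
    linarith
  · push Not at h
    have h2 : (M * q) ^ 2 ≤ b ^ 2 := pow_le_pow_left₀ (by positivity) h.le 2
    have h3 : (M * q) ^ 2 * (M * q ^ 4) ≤ b ^ 2 * (M * q ^ 4) :=
      mul_le_mul_of_nonneg_right h2 (by positivity)
    have h4 : 0 ≤ b ^ 2 * (M * q ^ 4) := by positivity
    nlinarith

lemma one_add_mul_le_rpow_of_nonpos {s q : ℝ} (hs : 0 < 1 + s) (hq : q ≤ 0) :
    1 + q * s ≤ (1 + s) ^ q := by
  rw [Real.rpow_def_of_pos hs]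
  have h1 := Real.add_one_le_exp (Real.log (1 + s) * q)
  have h2 := mul_le_mul_of_nonpos_right (Real.log_le_sub_one_of_pos hs) hq
  linarith

lemma sum_rpow_le {p : ℝ} (hp : 1 < p) (n : ℕ) :
    ∑ t ∈ Finset.Icc 1 n, (t : ℝ) ^ (-p) ≤ p / (p - 1) := by
  have hp1 : 0 < p - 1 := by linarith
  -- Subtracting the tail integral of `x ^ (-p)` makes the induction telescope.
  suffices h : ∀ n : ℕ, ∑ t ∈ Finset.Icc 1 (n + 1), (t : ℝ) ^ (-p) ≤
      p / (p - 1) - ((n + 1 : ℕ) : ℝ) ^ (1 - p) / (p - 1) by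
    rcases n with _ | n
    · simpa using by positivity
    · exact (h n).trans (sub_le_self _ (by positivity))
  intro n
  induction n with
  | zero => simp; field_simp; linarith
  | succ n ih =>
    rw [Finset.sum_Icc_succ_top (by omega)]
    set x : ℝ := ((n + 1 + 1 : ℕ) : ℝ) with hx
    have hy : ((n + 1 : ℕ) : ℝ) = x - 1 := by rw [hx]; push_cast; ring
    have hx1 : 1 < x := by rw [hx]; push_cast; linarith [(Nat.cast_nonneg n : (0 : ℝ) ≤ n)]
    rw [hy] at ih
    have hx0 : 0 < x := by linarith
    have key : (p - 1) * x ^ (-p) ≤ (x - 1) ^ (1 - p) - x ^ (1 - p) := by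
      have e1 : x - 1 = x * (1 + -(1 / x)) := by field_simp; ring
      have h2 : 1 + (1 - p) * (-(1 / x)) ≤ (1 + -(1 / x)) ^ (1 - p) :=
        one_add_mul_le_rpow_of_nonpos
          (by
            have : 1 / x < 1 := by rw [div_lt_one hx0]; exact hx1
            linarith) (by linarith)
      rw [e1, Real.mul_rpow hx0.le (by rw [← sub_eq_add_neg, sub_nonneg, div_le_one hx0]; exact hx1.le)]
      have e3 : x ^ (-p) = x ^ (1 - p) / x := by
        rw [show -p = (1 - p) - 1 by ring, Real.rpow_sub_one hx0.ne']
      rw [e3]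
      have := mul_le_mul_of_nonneg_left h2 (Real.rpow_nonneg hx0.le (1 - p))
      calc _ = x ^ (1 - p) * (1 + (1 - p) * (-(1 / x))) - x ^ (1 - p) := by field_simp; ring
        _ ≤ _ := by linarith
    have : x ^ (-p) ≤ ((x - 1) ^ (1 - p) - x ^ (1 - p)) / (p - 1) := by
      rw [le_div_iff₀ hp1]; linarith
    rw [sub_div] at this
    linarith

/-! ### Counts and measurability of the record -/

section Record

variable (σ α : ℝ) (O₁ : (Fin N → ℝ) → Fin K → Finset (Fin N))
  (O₂ : (Fin N → ℝ) → (Fin K → Finset (Fin N)) → Fin K)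
  (φ₀ : ℕ → Fin K → Finset (Fin N))

lemma ulcbRecord_congr {X Y : ℕ → Fin N → ℝ} {t : ℕ} (h : ∀ s ∈ Finset.Icc 1 t, X s = Y s) :
    ulcbRecord σ α O₁ O₂ φ₀ X t = ulcbRecord σ α O₁ O₂ φ₀ Y t := by
  induction t with
  | zero => rfl
  | succ t ih =>
    have h1 := ih fun s hs => h s (Finset.Icc_subset_Icc_right (Nat.le_succ t) hs)
    have h2 : X (t + 1) = Y (t + 1) := h _ (by simp)
    simp only [ulcbRecord, h1, h2]

lemma ulcbRecord_count_le (X : ℕ → Fin N → ℝ) (t : ℕ) (i : Fin N) :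
    (ulcbRecord σ α O₁ O₂ φ₀ X t).count i ≤ t := by
  induction t with
  | zero => simp [ulcbRecord]
  | succ t ih =>
    simp only [ulcbRecord]
    split_ifs <;> omega

lemma ulcbRecord_count_mono (X : ℕ → Fin N → ℝ) (i : Fin N) :
    Monotone fun t => (ulcbRecord σ α O₁ O₂ φ₀ X t).count i := by
  refine monotone_nat_of_le_succ fun t => ?_
  simp only [ulcbRecord]
  split_ifs <;> omega

lemma ulcbRecord_count_pos (X : ℕ → Fin N → ℝ) {t : ℕ} (ht : N ≤ t) (i : Fin N) :
    0 < (ulcbRecord σ α O₁ O₂ φ₀ X t).count i := by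
  refine lt_of_lt_of_le ?_ (ulcbRecord_count_mono σ α O₁ O₂ φ₀ X i
    (show i.val + 1 ≤ t from i.isLt.trans_le ht))
  have h : i.val + 1 ≤ N := i.isLt
  simp [ulcbRecord, observedItems, h]

lemma chosenAllocation_mem {A : Fin K → Set (Finset (Fin N))}
    {r : Fin K → (Fin N → ℝ) → Finset (Fin N) → ℝ} (hO₁ : IsMaxMinOracle A r O₁)
    (hφ₀ : ∀ t, φ₀ t ∈ allocations A) (t : ℕ) (s : Record N) :
    chosenAllocation σ α O₁ φ₀ t s ∈ allocations A := by
  unfold chosenAllocation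
  split_ifs
  exacts [hφ₀ t, (hO₁.1 _).1]

/-- The sum over rounds of any quantity charged per observed item according to how often the item
was observed before is the sum of the charges up to the final count. -/
lemma sum_observed_eq (X : ℕ → Fin N → ℝ) (h : ℕ → ℝ) (T : ℕ) :
    ∑ t ∈ Finset.range T,
        ∑ i ∈ observedItems σ α O₁ O₂ φ₀ (t + 1) (ulcbRecord σ α O₁ O₂ φ₀ X t),
          h ((ulcbRecord σ α O₁ O₂ φ₀ X t).count i) =
      ∑ i, ∑ k ∈ Finset.range ((ulcbRecord σ α O₁ O₂ φ₀ X T).count i), h k := by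
  induction T with
  | zero => simp [ulcbRecord]
  | succ T ih =>
    rw [Finset.sum_range_succ, ih,
      ← Finset.univ_inter (observedItems σ α O₁ O₂ φ₀ (T + 1) (ulcbRecord σ α O₁ O₂ φ₀ X T)),
      ← Finset.sum_ite_mem, ← Finset.sum_add_distrib]
    refine Finset.sum_congr rfl fun i _ => ?_
    simp only [ulcbRecord]
    split_ifs
    · rw [Finset.sum_range_succ]
    · rw [add_zero]

section Measurability

variable {A : Fin K → Set (Finset (Fin N))} {r : Fin K → (Fin N → ℝ) → Finset (Fin N) → ℝ}
  {Ω : Type*} [MeasurableSpace Ω]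

variable {O₁ O₂ φ₀} in
lemma measurableSet_chosenAllocation (hO₁ : IsMaxMinOracle A r O₁) {s : Ω → Record N}
    (hc : Measurable fun ω => (s ω).count) (ht : Measurable fun ω => (s ω).total) (t : ℕ)
    (φ : Fin K → Finset (Fin N)) :
    MeasurableSet {ω | chosenAllocation σ α O₁ φ₀ t (s ω) = φ} := by
  unfold chosenAllocation
  split_ifs with h
  · exact MeasurableSet.const _
  · have : Measurable fun ω => (s ω).ucb σ α t := by
      refine measurable_pi_lambda _ fun i => ?_
      have h1 : Measurable fun ω => ((s ω).count i : ℝ) :=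
        measurable_from_top.comp ((measurable_pi_apply i).comp hc)
      have h2 : Measurable fun ω => (s ω).total i := (measurable_pi_apply i).comp ht
      unfold Record.ucb Record.mean Record.width
      fun_prop
    exact this (hO₁.2 φ)

variable {O₁ O₂ φ₀} in
lemma measurableSet_mem_observedItems (hO₁ : IsMaxMinOracle A r O₁)
    (hO₂ : IsMinAgentOracle A r O₂) (hφ₀ : ∀ t, φ₀ t ∈ allocations A) {s : Ω → Record N}
    (hc : Measurable fun ω => (s ω).count) (ht : Measurable fun ω => (s ω).total) (t : ℕ)
    (i : Fin N) :
    MeasurableSet {ω | i ∈ observedItems σ α O₁ O₂ φ₀ t (s ω)} := by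
  unfold observedItems
  split_ifs with h
  · exact MeasurableSet.const _
  · have hlcb : Measurable fun ω => (s ω).lcb σ α t := by
      refine measurable_pi_lambda _ fun i => ?_
      have h1 : Measurable fun ω => ((s ω).count i : ℝ) :=
        measurable_from_top.comp ((measurable_pi_apply i).comp hc)
      have h2 : Measurable fun ω => (s ω).total i := (measurable_pi_apply i).comp ht
      unfold Record.lcb Record.mean Record.width
      fun_prop
    -- The second oracle is measurable only for each fixed feasible allocation, so the event is
    -- split over the finitely many pairs (allocation, agent).
    have : {ω | i ∈ chosenAllocation σ α O₁ φ₀ t (s ω)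
          (O₂ ((s ω).lcb σ α t) (chosenAllocation σ α O₁ φ₀ t (s ω)))} =
        ⋃ p ∈ {p : (Fin K → Finset (Fin N)) × Fin K | p.1 ∈ allocations A ∧ i ∈ p.1 p.2},
          ({ω | chosenAllocation σ α O₁ φ₀ t (s ω) = p.1} ∩
            (fun ω => (s ω).lcb σ α t) ⁻¹' {x | O₂ x p.1 = p.2}) := by
      ext ω
      simp only [Set.mem_ofPred_eq, Set.mem_iUnion, Set.mem_inter_iff, Set.mem_preimage]
      constructor
      · intro hi
        exact ⟨(_, _), ⟨chosenAllocation_mem σ α O₁ φ₀ hO₁ hφ₀ t _, hi⟩, rfl, rfl⟩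
      · rintro ⟨⟨φ, j⟩, ⟨-, hi⟩, h1, h2⟩
        simp only at h1 h2 hi
        rw [h1, h2]
        exact hi
    rw [this]
    exact MeasurableSet.biUnion (Set.to_countable _) fun p hp =>
      (measurableSet_chosenAllocation σ α hO₁ hc ht t p.1).inter (hlcb ((hO₂ p.1 hp.1).2 p.2))

variable {O₁ O₂ φ₀} in
lemma measurable_ulcbRecord (hO₁ : IsMaxMinOracle A r O₁)
    (hO₂ : IsMinAgentOracle A r O₂) (hφ₀ : ∀ t, φ₀ t ∈ allocations A) {X : Ω → ℕ → Fin N → ℝ}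
    (hX : Measurable X) (t : ℕ) :
    Measurable (fun ω => (ulcbRecord σ α O₁ O₂ φ₀ (X ω) t).count) ∧
      Measurable (fun ω => (ulcbRecord σ α O₁ O₂ φ₀ (X ω) t).total) := by
  induction t with
  | zero => exact ⟨measurable_const, measurable_const⟩
  | succ t ih =>
    have hS := measurableSet_mem_observedItems σ α hO₁ hO₂ hφ₀ ih.1 ih.2 (t + 1)
    refine ⟨measurable_pi_lambda _ fun i => ?_, measurable_pi_lambda _ fun i => ?_⟩
    · have h := (measurable_pi_apply i).comp ih.1
      exact Measurable.ite (hS i) (h.add_const 1) h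
    · have h := (measurable_pi_apply i).comp ih.2
      exact Measurable.ite (hS i)
        (h.add ((measurable_pi_apply i).comp ((measurable_pi_apply (t + 1)).comp hX))) h

end Measurability

end Record

/-! ### Exponential supermartingale and Chernoff bound -/

section Concentration

variable {Ω : Type*} [MeasurableSpace Ω] {P : Measure Ω}

lemma lintegral_exp_mul_sub_le_one {Y : Ω → ℝ} {σ : ℝ}
    (hY : HasSubgaussianMGF Y ⟨σ ^ 2, sq_nonneg σ⟩ P) (l : ℝ) :
    ∫⁻ ω, ENNReal.ofReal (Real.exp (l * Y ω - l ^ 2 * σ ^ 2 / 2)) ∂P ≤ 1 := by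
  have h1 : Integrable (fun ω => Real.exp (l * Y ω - l ^ 2 * σ ^ 2 / 2)) P := by
    simp_rw [Real.exp_sub]
    exact (hY.integrable_exp_mul l).div_const _
  rw [← ofReal_integral_eq_lintegral_ofReal h1 (Filter.Eventually.of_forall fun _ => by positivity),
    ENNReal.ofReal_le_one]
  simp_rw [Real.exp_sub]
  rw [integral_div, div_le_one (by positivity)]
  refine (hY.mgf_le l).trans (le_of_eq ?_)
  congr 1
  change σ ^ 2 * l ^ 2 / 2 = _
  ring

variable {A : Fin K → Set (Finset (Fin N))} {r : Fin K → (Fin N → ℝ) → Finset (Fin N) → ℝ}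
  {O₁ : (Fin N → ℝ) → Fin K → Finset (Fin N)}
  {O₂ : (Fin N → ℝ) → (Fin K → Finset (Fin N)) → Fin K}
  {φ₀ : ℕ → Fin K → Finset (Fin N)}

/-- The record depends on the past noise alone, which makes it independent of the next noise vector.
Noise outside rounds `1, …, t` is replaced by zero. -/
lemma exists_ulcbRecord_eq_comp (σ α : ℝ) (hO₁ : IsMaxMinOracle A r O₁)
    (hO₂ : IsMinAgentOracle A r O₂) (hφ₀ : ∀ t, φ₀ t ∈ allocations A) (μ : Fin N → ℝ) (t : ℕ) :
    ∃ G : (Finset.Icc 1 t → Fin N → ℝ) → Record N,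
      Measurable (fun v => (G v).count) ∧ Measurable (fun v => (G v).total) ∧
      ∀ e : ℕ → Fin N → ℝ, ulcbRecord σ α O₁ O₂ φ₀ (fun s i => μ i + e s i) t =
        G fun s => e s := by
  let X : (Finset.Icc 1 t → Fin N → ℝ) → ℕ → Fin N → ℝ := fun v s i =>
    μ i + if h : s ∈ Finset.Icc 1 t then v ⟨s, h⟩ i else 0
  have hX : Measurable X := by
    refine measurable_pi_lambda _ fun s => measurable_pi_lambda _ fun i => ?_
    by_cases h : s ∈ Finset.Icc 1 t
    · simp only [X, dif_pos h]
      fun_prop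
    · simp only [X, dif_neg h]
      fun_prop
  obtain ⟨h1, h2⟩ := measurable_ulcbRecord σ α hO₁ hO₂ hφ₀ hX t
  refine ⟨_, h1, h2, fun e => ulcbRecord_congr σ α O₁ O₂ φ₀ fun s hs => ?_⟩
  simp only [X, dif_pos hs]

variable [IsProbabilityMeasure P] {ε : ℕ → Ω → Fin N → ℝ} {σ : ℝ}

/-- The exponential process of the noise collected on item `i` has expectation at most one. -/
lemma lintegral_exp_record_le_one (α : ℝ) (hO₁ : IsMaxMinOracle A r O₁)
    (hO₂ : IsMinAgentOracle A r O₂) (hφ₀ : ∀ t, φ₀ t ∈ allocations A) (μ : Fin N → ℝ)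
    (hε_meas : ∀ t, Measurable (ε t)) (hε_indep : iIndepFun ε P)
    (hε_subG : ∀ t i, HasSubgaussianMGF (fun ω => ε t ω i) ⟨σ ^ 2, sq_nonneg σ⟩ P)
    (l : ℝ) (i : Fin N) (t : ℕ) :
    ∫⁻ ω, ENNReal.ofReal (Real.exp
      (l * ((ulcbRecord σ α O₁ O₂ φ₀ (fun s i => μ i + ε s ω i) t).total i -
          (ulcbRecord σ α O₁ O₂ φ₀ (fun s i => μ i + ε s ω i) t).count i * μ i) -
        l ^ 2 * σ ^ 2 / 2 *
          (ulcbRecord σ α O₁ O₂ φ₀ (fun s i => μ i + ε s ω i) t).count i)) ∂P ≤ 1 := by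
  induction t with
  | zero => simp [ulcbRecord]
  | succ t ih =>
    obtain ⟨G, hGc, hGt, hG⟩ := exists_ulcbRecord_eq_comp σ α hO₁ hO₂ hφ₀ μ t
    set v : Ω → Finset.Icc 1 t → Fin N → ℝ := fun ω s => ε s ω with hv
    have hvm : Measurable v := measurable_pi_lambda _ fun s => hε_meas s
    have hG' : ∀ ω, ulcbRecord σ α O₁ O₂ φ₀ (fun s i => μ i + ε s ω i) t = G (v ω) :=
      fun ω => hG fun s => ε s ω
    have hS := measurableSet_mem_observedItems σ α hO₁ hO₂ hφ₀ hGc hGt (t + 1) i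
    set S := {u | i ∈ observedItems σ α O₁ O₂ φ₀ (t + 1) (G u)} with hSdef
    let W : (Finset.Icc 1 t → Fin N → ℝ) → ENNReal := fun u => ENNReal.ofReal (Real.exp
      (l * ((G u).total i - (G u).count i * μ i) - l ^ 2 * σ ^ 2 / 2 * (G u).count i))
    have hW : Measurable W := by
      have h1 : Measurable fun u => ((G u).count i : ℝ) :=
        measurable_from_top.comp ((measurable_pi_apply i).comp hGc)
      have h2 : Measurable fun u => (G u).total i := (measurable_pi_apply i).comp hGt
      fun_prop
    let E : (Fin N → ℝ) → ENNReal := fun x =>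
      ENNReal.ofReal (Real.exp (l * x i - l ^ 2 * σ ^ 2 / 2))
    have hE : Measurable E := by fun_prop
    -- Whether `i` is observed in round `t + 1` is decided by the past `v ω`. Off `S` the process is
    -- unchanged; on `S` it gains the factor `E`, independent of the past and of mean at most one.
    have hstep : ∀ ω, ENNReal.ofReal (Real.exp
        (l * ((ulcbRecord σ α O₁ O₂ φ₀ (fun s i => μ i + ε s ω i) (t + 1)).total i -
            (ulcbRecord σ α O₁ O₂ φ₀ (fun s i => μ i + ε s ω i) (t + 1)).count i * μ i) -
          l ^ 2 * σ ^ 2 / 2 *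
            (ulcbRecord σ α O₁ O₂ φ₀ (fun s i => μ i + ε s ω i) (t + 1)).count i)) =
        Sᶜ.indicator W (v ω) + S.indicator W (v ω) * E (ε (t + 1) ω) := by
      intro ω
      simp only [ulcbRecord, hG']
      by_cases h : v ω ∈ S
      · have h' : i ∈ observedItems σ α O₁ O₂ φ₀ (t + 1) (G (v ω)) := h
        rw [Set.indicator_of_notMem (Set.notMem_compl_iff.2 h), Set.indicator_of_mem h, zero_add]
        simp only [if_pos h', W, E]
        rw [← ENNReal.ofReal_mul (Real.exp_nonneg _), ← Real.exp_add]
        congr 2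
        push_cast
        ring
      · have h' : i ∉ observedItems σ α O₁ O₂ φ₀ (t + 1) (G (v ω)) := h
        rw [Set.indicator_of_mem (Set.mem_compl h), Set.indicator_of_notMem h]
        simp only [if_neg h', W, zero_mul, add_zero]
    have hind : IndepFun (fun ω => S.indicator W (v ω)) (fun ω => E (ε (t + 1) ω)) P := by
      have h1 := hε_indep.indepFun_finset (Finset.Icc 1 t) {t + 1} (by simp) hε_meas
      have h2 : Measurable fun u : ({t + 1} : Finset ℕ) → Fin N → ℝ =>
          E (u ⟨t + 1, Finset.mem_singleton_self _⟩) := hE.comp (measurable_pi_apply _)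
      exact h1.comp (hW.indicator hS) h2
    have hV : Measurable fun ω => Sᶜ.indicator W (v ω) := (hW.indicator hS.compl).comp hvm
    have hEle : ∫⁻ ω, E (ε (t + 1) ω) ∂P ≤ 1 := lintegral_exp_mul_sub_le_one (hε_subG (t + 1) i) l
    have hmul := lintegral_mul_eq_lintegral_mul_lintegral_of_indepFun
      ((hW.indicator hS).comp hvm) (hE.comp (hε_meas (t + 1))) hind
    simp only [Pi.mul_apply, Function.comp_def] at hmul
    calc _ = ∫⁻ ω, (Sᶜ.indicator W (v ω) + S.indicator W (v ω) * E (ε (t + 1) ω)) ∂P :=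
          lintegral_congr hstep
      _ = ∫⁻ ω, Sᶜ.indicator W (v ω) ∂P +
            (∫⁻ ω, S.indicator W (v ω) ∂P) * ∫⁻ ω, E (ε (t + 1) ω) ∂P := by
          rw [lintegral_add_left hV, ← hmul]
      _ ≤ ∫⁻ ω, Sᶜ.indicator W (v ω) ∂P + (∫⁻ ω, S.indicator W (v ω) ∂P) * 1 := by gcongr
      _ = ∫⁻ ω, W (v ω) ∂P := by
          rw [mul_one, ← lintegral_add_left hV]
          exact lintegral_congr fun ω => congrFun (Set.indicator_compl_add_self S W) _
      _ ≤ 1 := by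
          simp only [hG'] at ih
          exact ih

/-- Chernoff bound for the noise collected on item `i` when it has been observed `n` times. -/
lemma measure_record_deviation_le (α : ℝ) (hO₁ : IsMaxMinOracle A r O₁)
    (hO₂ : IsMinAgentOracle A r O₂) (hφ₀ : ∀ t, φ₀ t ∈ allocations A) (μ : Fin N → ℝ)
    (hε_meas : ∀ t, Measurable (ε t)) (hε_indep : iIndepFun ε P)
    (hε_subG : ∀ t i, HasSubgaussianMGF (fun ω => ε t ω i) ⟨σ ^ 2, sq_nonneg σ⟩ P)
    (l x : ℝ) (n : ℕ) (i : Fin N) (t : ℕ) :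
    P {ω | (ulcbRecord σ α O₁ O₂ φ₀ (fun s i => μ i + ε s ω i) t).count i = n ∧
        x ≤ l * ((ulcbRecord σ α O₁ O₂ φ₀ (fun s i => μ i + ε s ω i) t).total i - n * μ i)} ≤
      ENNReal.ofReal (Real.exp (l ^ 2 * σ ^ 2 / 2 * n - x)) := by
  have h1 := lintegral_exp_record_le_one α hO₁ hO₂ hφ₀ μ hε_meas hε_indep hε_subG l i t
  have hX : Measurable fun ω s i => μ i + ε s ω i := by
    refine measurable_pi_lambda _ fun s => measurable_pi_lambda _ fun i => ?_
    exact measurable_const.add ((measurable_pi_apply i).comp (hε_meas s))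
  obtain ⟨hc, ht⟩ := measurable_ulcbRecord σ α hO₁ hO₂ hφ₀ hX t
  have hc1 : Measurable fun ω =>
      ((ulcbRecord σ α O₁ O₂ φ₀ (fun s i => μ i + ε s ω i) t).count i : ℝ) :=
    measurable_from_top.comp ((measurable_pi_apply i).comp hc)
  have ht1 : Measurable fun ω =>
      (ulcbRecord σ α O₁ O₂ φ₀ (fun s i => μ i + ε s ω i) t).total i :=
    (measurable_pi_apply i).comp ht
  -- Markov's inequality for the exponential process, at the value it exceeds when the count is `n`.
  have h2 := mul_meas_ge_le_lintegral (μ := P) (f := fun ω => ENNReal.ofReal (Real.exp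
      (l * ((ulcbRecord σ α O₁ O₂ φ₀ (fun s i => μ i + ε s ω i) t).total i -
          (ulcbRecord σ α O₁ O₂ φ₀ (fun s i => μ i + ε s ω i) t).count i * μ i) -
        l ^ 2 * σ ^ 2 / 2 *
          (ulcbRecord σ α O₁ O₂ φ₀ (fun s i => μ i + ε s ω i) t).count i)))
    (by fun_prop) (ENNReal.ofReal (Real.exp (x - l ^ 2 * σ ^ 2 / 2 * n)))
  have h3 := h2.trans h1
  have h4 : ENNReal.ofReal (Real.exp (l ^ 2 * σ ^ 2 / 2 * n - x)) =
      (ENNReal.ofReal (Real.exp (x - l ^ 2 * σ ^ 2 / 2 * n)))⁻¹ := by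
    rw [← ENNReal.ofReal_inv_of_pos (Real.exp_pos _), ← Real.exp_neg, neg_sub]
  rw [h4]
  refine (measure_mono ?_).trans ((ENNReal.le_inv_iff_mul_le).2 (by rwa [mul_comm] at h3))
  rintro ω ⟨hω, hx⟩
  simp only [Set.mem_ofPred_eq, hω]
  gcongr

end Concentration

/-- Some empirical mean deviates from `μ` in the direction of `η` by more than its confidence
width. -/
def Deviates (σ α η : ℝ) (μ : Fin N → ℝ) (t : ℕ) (s : Record N) : Prop :=
  ∃ i, s.width σ α t i < η * (s.mean i - μ i)

lemma sum_Icc_one_eq_sum_range {M : Type*} [AddCommMonoid M] (f : ℕ → M) (n : ℕ) :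
    ∑ t ∈ Finset.Icc 1 n, f t = ∑ t ∈ Finset.range n, f (t + 1) := by
  induction n with
  | zero => simp
  | succ n ih => rw [Finset.sum_Icc_succ_top (by omega), ih, Finset.sum_range_succ]

variable {A : Fin K → Set (Finset (Fin N))} {r : Fin K → (Fin N → ℝ) → Finset (Fin N) → ℝ}
  {O₁ : (Fin N → ℝ) → Fin K → Finset (Fin N)}
  {O₂ : (Fin N → ℝ) → (Fin K → Finset (Fin N)) → Fin K}
  {φ₀ : ℕ → Fin K → Finset (Fin N)}

open Classical in
/-- The loss of a single round after the initial ones. -/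
lemma round_gap_le [Nontrivial (Fin K)] (hA : ∀ j, ∅ ∈ A j) {c : ℝ} (hc : 0 ≤ c)
    (hr : LipschitzMonotone A r c) {μ : Fin N → ℝ} {Δ : ℝ} (hΔ : RewardSpread A r μ Δ)
    (hO₁ : IsMaxMinOracle A r O₁) (hO₂ : IsMinAgentOracle A r O₂) (σ α : ℝ) {t : ℕ} (ht : N < t)
    (s : Record N) :
    maxMin A r μ - minReward r μ (chosenAllocation σ α O₁ φ₀ t s) ≤
      ∑ i ∈ observedItems σ α O₁ O₂ φ₀ t s, min (2 * Δ) (2 * c * s.width σ α t i) +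
        (if Deviates σ α (-1) μ t s then Δ else 0) + if Deviates σ α 1 μ t s then 2 * Δ else 0 := by
  have hΔ0 := hΔ.nonneg hA
  simp only [observedItems, chosenAllocation, if_neg ht.not_ge]
  obtain ⟨hφ, hmax⟩ := hO₁.1 (s.ucb σ α t)
  set φ := O₁ (s.ucb σ α t)
  have hj := (hO₂ φ hφ).1 (s.lcb σ α t)
  set j := O₂ (s.lcb σ α t) φ
  have hgap := hΔ.gap_le hA hφ
  have hw : ∀ i, 0 ≤ s.width σ α t i := fun i => Real.sqrt_nonneg _
  have hsum0 : 0 ≤ ∑ i ∈ φ j, min (2 * Δ) (2 * c * s.width σ α t i) :=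
    Finset.sum_nonneg fun i _ => le_min (by linarith) (mul_nonneg (by linarith) (hw i))
  have hsum : min (2 * Δ) (c * ∑ i ∈ φ j, |s.ucb σ α t i - s.lcb σ α t i|) ≤
      ∑ i ∈ φ j, min (2 * Δ) (2 * c * s.width σ α t i) := by
    have e : c * ∑ i ∈ φ j, |s.ucb σ α t i - s.lcb σ α t i| =
        ∑ i ∈ φ j, 2 * c * s.width σ α t i := by
      rw [Finset.mul_sum]
      refine Finset.sum_congr rfl fun i _ => ?_
      have : s.ucb σ α t i - s.lcb σ α t i = 2 * s.width σ α t i := by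
        unfold Record.ucb Record.lcb; ring
      rw [this, abs_of_nonneg (by linarith [hw i])]
      ring
    rw [e]
    exact min_sum_le_sum_min _ (by linarith) fun i _ => mul_nonneg (by linarith) (hw i)
  by_cases hL : Deviates σ α 1 μ t s
  · rw [if_pos hL]
    have : 0 ≤ if Deviates σ α (-1) μ t s then Δ else 0 := by split_ifs <;> linarith
    linarith
  · have hlo : ∀ i, s.lcb σ α t i ≤ μ i := by
      intro i
      by_contra! h
      exact hL ⟨i, by unfold Record.lcb at h; linarith⟩
    rw [if_neg hL, add_zero]
    by_cases hU : Deviates σ α (-1) μ t s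
    · rw [if_pos hU]
      have h1 := gap_le_of_lower hr hA hΔ hφ hmax hj hlo
      -- The trivial bound `2 Δ` on the loss keeps the truncation valid after `Δ` is subtracted.
      have h2 : maxMin A r μ - minReward r μ φ - Δ ≤
          min (2 * Δ) (c * ∑ i ∈ φ j, |s.ucb σ α t i - s.lcb σ α t i|) :=
        le_min (by linarith) (by linarith)
      linarith
    · have hhi : ∀ i, μ i ≤ s.ucb σ α t i := by
        intro i
        by_contra! h
        exact hU ⟨i, by unfold Record.ucb at h; linarith⟩
      rw [if_neg hU, add_zero]
      exact (le_min hgap (gap_le_of_mem_interval hr hA hφ hmax hj hlo hhi)).trans hsum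

lemma width_le {σ α : ℝ} (hα : 0 ≤ α) {t T : ℕ} (h1 : 1 ≤ t) (hT : t ≤ T) (s : Record N)
    (i : Fin N) : s.width σ α t i ≤ √(2 * σ ^ 2 * (α * Real.log T)) / √(s.count i : ℝ) := by
  have ht0 : (0 : ℝ) < t := by exact_mod_cast h1
  rw [← Real.sqrt_div' _ (Nat.cast_nonneg _), Record.width, Real.log_rpow ht0,
    one_div, mul_comm, ← div_eq_mul_inv]
  have : Real.log t ≤ Real.log T := Real.log_le_log ht0 (by exact_mod_cast hT)
  gcongr

lemma minReward_le_maxMin (r : Fin K → (Fin N → ℝ) → Finset (Fin N) → ℝ) (x : Fin N → ℝ)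
    {φ : Fin K → Finset (Fin N)} (hφ : φ ∈ allocations A) : minReward r x φ ≤ maxMin A r x :=
  le_csSup ((Set.toFinite _).image _).bddAbove (Set.mem_image_of_mem _ hφ)

/-! ### Probability that a confidence bound fails -/

section Probability

variable {Ω : Type*} [MeasurableSpace Ω] {P : Measure Ω}

lemma measurableSet_deviates (σ α η : ℝ) (μ : Fin N → ℝ) (t : ℕ) {s : Ω → Record N}
    (hc : Measurable fun ω => (s ω).count) (ht : Measurable fun ω => (s ω).total) :
    MeasurableSet {ω | Deviates σ α η μ t (s ω)} := by
  have : {ω | Deviates σ α η μ t (s ω)} =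
      ⋃ i, {ω | (s ω).width σ α t i < η * ((s ω).mean i - μ i)} := by
    ext ω; simp [Deviates]
  rw [this]
  refine MeasurableSet.iUnion fun i => ?_
  have h1 : Measurable fun ω => ((s ω).count i : ℝ) :=
    measurable_from_top.comp ((measurable_pi_apply i).comp hc)
  have h2 : Measurable fun ω => (s ω).total i := (measurable_pi_apply i).comp ht
  unfold Record.width Record.mean
  exact measurableSet_lt (by fun_prop) (by fun_prop)

variable [IsProbabilityMeasure P] {ε : ℕ → Ω → Fin N → ℝ} {σ : ℝ}

lemma measure_deviates_le (hσ : 0 < σ) {α : ℝ} (hα : 0 ≤ α) (hO₁ : IsMaxMinOracle A r O₁)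
    (hO₂ : IsMinAgentOracle A r O₂) (hφ₀ : ∀ t, φ₀ t ∈ allocations A) (μ : Fin N → ℝ)
    (hε_meas : ∀ t, Measurable (ε t)) (hε_indep : iIndepFun ε P)
    (hε_subG : ∀ t i, HasSubgaussianMGF (fun ω => ε t ω i) ⟨σ ^ 2, sq_nonneg σ⟩ P)
    {η : ℝ} (hη : η ^ 2 = 1) {t : ℕ} (ht : N ≤ t) :
    P.real {ω | Deviates σ α η μ (t + 1)
        (ulcbRecord σ α O₁ O₂ φ₀ (fun s i => μ i + ε s ω i) t)} ≤
      N * ((t + 1 : ℕ) : ℝ) ^ (-(α - 1)) := by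
  set R : Ω → Record N := fun ω => ulcbRecord σ α O₁ O₂ φ₀ (fun s i => μ i + ε s ω i) t with hR
  have ht0 : (0 : ℝ) < ((t + 1 : ℕ) : ℝ) := by positivity
  set β : ℝ := α * Real.log ((t + 1 : ℕ) : ℝ) with hβ
  have hβ0 : 0 ≤ β := mul_nonneg hα (Real.log_natCast_nonneg _)
  let w : ℕ → ℝ := fun n => √(1 / (n : ℝ) * (2 * σ ^ 2 * β))
  let B : Fin N → ℕ → Set Ω := fun i n =>
    {ω | (R ω).count i = n ∧ 2 * β ≤ η * w n / σ ^ 2 * ((R ω).total i - n * μ i)}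
  -- The count is random and depends on the data, so the union runs over all its values. It is
  -- positive because `N ≤ t`, which excludes division by zero in the mean and width.
  have hsub : {ω | Deviates σ α η μ (t + 1) (R ω)} ⊆ ⋃ i, ⋃ n ∈ Finset.Icc 1 t, B i n := by
    rintro ω ⟨i, hi⟩
    have hpos : 0 < (R ω).count i := ulcbRecord_count_pos σ α O₁ O₂ φ₀ _ ht i
    have hle : (R ω).count i ≤ t := ulcbRecord_count_le σ α O₁ O₂ φ₀ _ t i
    refine Set.mem_iUnion.2 ⟨i, Set.mem_biUnion (Finset.mem_Icc.2 ⟨hpos, hle⟩) ⟨rfl, ?_⟩⟩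
    have hn : (0 : ℝ) < (R ω).count i := by exact_mod_cast hpos
    have hwe : (R ω).width σ α (t + 1) i = w ((R ω).count i) := by
      simp only [Record.width, w, hβ, Real.log_rpow ht0]
    rw [hwe] at hi
    unfold Record.mean at hi
    have hw0 : 0 ≤ w ((R ω).count i) := Real.sqrt_nonneg _
    have hw2 : w ((R ω).count i) ^ 2 = 1 / ((R ω).count i : ℝ) * (2 * σ ^ 2 * β) :=
      Real.sq_sqrt (by positivity)
    generalize w ((R ω).count i) = x at *
    generalize ((R ω).count i : ℝ) = n at *
    have h1 := mul_le_mul_of_nonneg_left hi.le (show 0 ≤ n * x / σ ^ 2 by positivity)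
    have e1 : n * x / σ ^ 2 * x = 2 * β := by
      rw [show n * x / σ ^ 2 * x = n * x ^ 2 / σ ^ 2 by ring, hw2]; field_simp
    have e2 : n * x / σ ^ 2 * (η * ((R ω).total i / n - μ i)) =
        η * x / σ ^ 2 * ((R ω).total i - n * μ i) := by field_simp
    linarith
  have hB : ∀ i, ∀ n ∈ Finset.Icc 1 t,
      P (B i n) ≤ ENNReal.ofReal (((t + 1 : ℕ) : ℝ) ^ (-α)) := by
    intro i n hn
    have hn0 : (0 : ℝ) < n := by exact_mod_cast (Finset.mem_Icc.1 hn).1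
    refine (measure_record_deviation_le α hO₁ hO₂ hφ₀ μ hε_meas hε_indep hε_subG
      (η * w n / σ ^ 2) (2 * β) n i t).trans (le_of_eq ?_)
    have hw2 : w n ^ 2 = 1 / (n : ℝ) * (2 * σ ^ 2 * β) := Real.sq_sqrt (by positivity)
    -- The Chernoff parameter `η w / σ²` is the optimal one: the exponent is `β - 2 β = -β`.
    have e : (η * w n / σ ^ 2) ^ 2 * σ ^ 2 / 2 * n - 2 * β =
        Real.log ((t + 1 : ℕ) : ℝ) * (-α) := by
      rw [div_pow, mul_pow, hη, hw2, hβ]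
      field_simp
      ring
    rw [e, Real.rpow_def_of_pos ht0]
  have hP : P {ω | Deviates σ α η μ (t + 1) (R ω)} ≤
      ENNReal.ofReal (N * (t * ((t + 1 : ℕ) : ℝ) ^ (-α))) := by
    calc _ ≤ ∑ i, ∑ n ∈ Finset.Icc 1 t, P (B i n) :=
          (measure_mono hsub).trans ((measure_iUnion_fintype_le _ _).trans
            (Finset.sum_le_sum fun i _ => measure_biUnion_finset_le _ _))
      _ ≤ ∑ _i : Fin N, ∑ _n ∈ Finset.Icc 1 t, ENNReal.ofReal (((t + 1 : ℕ) : ℝ) ^ (-α)) :=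
          Finset.sum_le_sum fun i _ => Finset.sum_le_sum (hB i)
      _ = _ := by
          rw [ENNReal.ofReal_mul (Nat.cast_nonneg _), ENNReal.ofReal_mul (Nat.cast_nonneg _)]
          simp
  refine (ENNReal.toReal_mono ENNReal.ofReal_ne_top hP).trans ?_
  rw [ENNReal.toReal_ofReal (by positivity)]
  refine mul_le_mul_of_nonneg_left ?_ (Nat.cast_nonneg _)
  -- The `t` possible counts cost one power of `t + 1`.
  rw [show -(α - 1) = 1 + -α by ring, Real.rpow_add ht0, Real.rpow_one]
  gcongr
  exact Nat.le_succ t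

end Probability

/-! ### Constants and the regret bound -/

lemma mul_sum_min_le {Δ c σ α : ℝ} (hΔ : 0 ≤ Δ) (hc : 0 ≤ c) (hα : 0 ≤ α) (N T : ℕ) :
    N * ∑ k ∈ Finset.range (T + 1),
        min (2 * Δ) (2 * c * √(2 * σ ^ 2 * (α * Real.log T)) / √(k : ℝ)) ≤
      (4.5 : ℝ) ^ (2 / 3 : ℝ) *
        (Δ * (N : ℝ) ^ 3 * c ^ 2 * (√(2 * α) + 2) ^ 2 * σ ^ 2 * Real.log T) ^ (1 / 3 : ℝ) *
        (T : ℝ) ^ (2 / 3 : ℝ) := by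
  have hlog : 0 ≤ Real.log (T : ℝ) := Real.log_natCast_nonneg _
  have h := sum_min_div_sqrt_pow_three_le (M := 2 * Δ)
    (b := 2 * c * √(2 * σ ^ 2 * (α * Real.log T))) (by positivity) (by positivity) T
  set y := ∑ k ∈ Finset.range (T + 1),
    min (2 * Δ) (2 * c * √(2 * σ ^ 2 * (α * Real.log T)) / √(k : ℝ))
  have hQ : 0 ≤ Δ * (N : ℝ) ^ 3 * c ^ 2 * (√(2 * α) + 2) ^ 2 * σ ^ 2 * Real.log T := by positivity
  refine le_of_pow_le_pow_left₀ three_ne_zero (by positivity) ?_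
  have e : ∀ x : ℝ, 0 ≤ x → (x ^ (2 / 3 : ℝ)) ^ 3 = x ^ 2 := fun x hx => by
    rw [← Real.rpow_natCast, ← Real.rpow_mul hx, ← Real.rpow_natCast]; norm_num
  have e' : ∀ x : ℝ, 0 ≤ x → (x ^ (1 / 3 : ℝ)) ^ 3 = x := fun x hx => by
    rw [← Real.rpow_natCast, ← Real.rpow_mul hx]; norm_num
  rw [mul_pow, mul_pow, mul_pow, e _ (by norm_num), e' _ hQ, e _ (Nat.cast_nonneg T)]
  rw [mul_pow, mul_pow, Real.sq_sqrt (by positivity)] at h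
  have h2 : 2 * α ≤ (√(2 * α) + 2) ^ 2 := by
    nlinarith [Real.sq_sqrt (show 0 ≤ 2 * α by positivity), Real.sqrt_nonneg (2 * α)]
  set Z := Δ * (N : ℝ) ^ 3 * c ^ 2 * σ ^ 2 * Real.log T * (T : ℝ) ^ 2 with hZdef
  have hZ : 0 ≤ Z := by positivity
  calc (N : ℝ) ^ 3 * y ^ 3
      ≤ (N : ℝ) ^ 3 * (27 / 16 * (2 * Δ * (2 ^ 2 * c ^ 2 * (2 * σ ^ 2 * (α * Real.log T))) *
          (T : ℝ) ^ 2)) := mul_le_mul_of_nonneg_left h (by positivity)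
    _ = 27 / 2 * (Z * (2 * α)) := by rw [hZdef]; ring
    -- There is slack in both factors: `27/2 ≤ 4.5²` and `2 α ≤ (√(2 α) + 2)²`.
    _ ≤ 4.5 ^ 2 * (Z * (√(2 * α) + 2) ^ 2) := by
        refine mul_le_mul (by norm_num) (mul_le_mul_of_nonneg_left h2 hZ) (by positivity)
          (by norm_num)
    _ = _ := by rw [hZdef]; ring

end FairBundle

end

theorem mainTheorem10 {Ω : Type*} [MeasurableSpace Ω] (P : Measure Ω) [IsProbabilityMeasure P]
    {K N : ℕ} (hK : 2 ≤ K)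
    (A : Fin K → Set (Finset (Fin N))) (hA : ∀ j, ∅ ∈ A j)
    (r : Fin K → (Fin N → ℝ) → Finset (Fin N) → ℝ)
    (c : ℝ) (hc : 0 < c) (hr : FairBundle.LipschitzMonotone A r c)
    (μ : Fin N → ℝ) (Δmax : ℝ)
    (hΔ : ∀ φ ∈ FairBundle.allocations A, ∀ i j : Fin K, i ≠ j →
      |r j μ (φ j) - r i μ (φ i)| ≤ Δmax)
    (σ : ℝ) (hσ : 0 < σ) (α : ℝ) (hα : 2 < α)
    (ε : ℕ → Ω → Fin N → ℝ) (hε_meas : ∀ t, Measurable (ε t))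
    (hε_indep : iIndepFun ε P)
    (hε_ident : ∀ s t, IdentDistrib (ε s) (ε t) P P)
    (hε_subG : ∀ t i, HasSubgaussianMGF (fun ω => ε t ω i) ⟨σ ^ 2, sq_nonneg σ⟩ P)
    (O₁ : (Fin N → ℝ) → Fin K → Finset (Fin N)) (hO₁ : FairBundle.IsMaxMinOracle A r O₁)
    (O₂ : (Fin N → ℝ) → (Fin K → Finset (Fin N)) → Fin K)
    (hO₂ : FairBundle.IsMinAgentOracle A r O₂)
    (φ₀ : ℕ → Fin K → Finset (Fin N)) (hφ₀ : ∀ t, φ₀ t ∈ FairBundle.allocations A)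
    (T : ℕ) (hT : N < T) :
    Integrable (fun ω => FairBundle.cumulativeShortfall A r μ σ α O₁ O₂ φ₀
        (fun t i => μ i + ε t ω i) T) P ∧
      ∫ ω, FairBundle.cumulativeShortfall A r μ σ α O₁ O₂ φ₀
          (fun t i => μ i + ε t ω i) T ∂P ≤
        3 * Δmax * N * ((α - 1) / (α - 2) + 2) +
          (4.5 : ℝ) ^ (2 / 3 : ℝ) *
            (Δmax * (N : ℝ) ^ 3 * c ^ 2 * (√(2 * α) + 2) ^ 2 * σ ^ 2 * Real.log T) ^ (1 / 3 : ℝ) *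
            (T : ℝ) ^ (2 / 3 : ℝ) := by
  classical
  open FairBundle in
  have : Nontrivial (Fin K) := Fin.nontrivial_iff_two_le.2 hK
  have hΔ' : RewardSpread A r μ Δmax := hΔ
  have hΔ0 : 0 ≤ Δmax := hΔ'.nonneg hA
  have hα0 : 0 ≤ α := by linarith
  set R : ℕ → Ω → Record N :=
    fun t ω => ulcbRecord σ α O₁ O₂ φ₀ (fun s i => μ i + ε s ω i) t with hR
  have hX : Measurable fun ω s i => μ i + ε s ω i :=
    measurable_pi_lambda _ fun s => measurable_pi_lambda _ fun i =>
      measurable_const.add ((measurable_pi_apply i).comp (hε_meas s))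
  have hRm := fun t => measurable_ulcbRecord σ α hO₁ hO₂ hφ₀ hX t
  let g : ℕ → Ω → ℝ := fun t ω =>
    maxMin A r μ - minReward r μ (chosenAllocation σ α O₁ φ₀ (t + 1) (R t ω))
  have hmem : ∀ t ω, chosenAllocation σ α O₁ φ₀ (t + 1) (R t ω) ∈ allocations A := fun t ω =>
    chosenAllocation_mem σ α O₁ φ₀ hO₁ hφ₀ _ _
  have hg2 : ∀ t ω, g t ω ≤ 2 * Δmax := fun t ω => hΔ'.gap_le hA (hmem t ω)
  have hcum : ∀ ω, cumulativeShortfall A r μ σ α O₁ O₂ φ₀ (fun t i => μ i + ε t ω i) T =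
      ∑ t ∈ Finset.range T, g t ω := fun ω => sum_Icc_one_eq_sum_range _ T
  have hgi : ∀ t, Integrable (g t) P := by
    intro t
    let : MeasurableSpace (Fin K → Finset (Fin N)) := ⊤
    have h1 : Measurable fun ω => chosenAllocation σ α O₁ φ₀ (t + 1) (R t ω) :=
      measurable_to_countable' fun φ =>
        measurableSet_chosenAllocation σ α hO₁ (hRm t).1 (hRm t).2 (t + 1) φ
    have h2 : Measurable (g t) :=
      (measurable_from_top (f := fun φ => maxMin A r μ - minReward r μ φ)).comp h1
    refine Integrable.of_bound h2.aestronglyMeasurable (2 * Δmax)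
      (Filter.Eventually.of_forall fun ω => ?_)
    rw [Real.norm_of_nonneg (sub_nonneg.2 (minReward_le_maxMin r μ (hmem t ω)))]
    exact hg2 t ω
  have hint : Integrable (fun ω => ∑ t ∈ Finset.range T, g t ω) P :=
    integrable_finsetSum _ fun t _ => hgi t
  simp_rw [hcum]
  refine ⟨hint, ?_⟩
  -- Initial rounds are excluded: a count may still be zero there, and the deviation bound does not
  -- apply. They are charged `2 Δmax` each.
  let B : ℝ → ℕ → Set Ω := fun η t => {ω | N ≤ t ∧ Deviates σ α η μ (t + 1) (R t ω)}
  have hBm : ∀ η t, MeasurableSet (B η t) := fun η t =>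
    (MeasurableSet.const (N ≤ t)).inter
      (measurableSet_deviates σ α η μ (t + 1) (hRm t).1 (hRm t).2)
  have hBP : ∀ η : ℝ, η ^ 2 = 1 → ∀ t, P.real (B η t) ≤ N * ((t + 1 : ℕ) : ℝ) ^ (-(α - 1)) := by
    intro η hη t
    by_cases ht : N ≤ t
    · simpa [B, ht] using
        measure_deviates_le hσ hα0 hO₁ hO₂ hφ₀ μ hε_meas hε_indep hε_subG hη ht
    · simp only [B, ht, false_and, Set.ofPred_false, measureReal_empty]
      positivity
  have hBsum : ∀ η : ℝ, η ^ 2 = 1 →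
      ∑ t ∈ Finset.range T, P.real (B η t) ≤ N * ((α - 1) / (α - 2)) := by
    intro η hη
    refine (Finset.sum_le_sum fun t _ => hBP η hη t).trans ?_
    rw [← Finset.mul_sum, ← sum_Icc_one_eq_sum_range fun t : ℕ => (t : ℝ) ^ (-(α - 1))]
    refine mul_le_mul_of_nonneg_left ?_ (Nat.cast_nonneg _)
    have h := sum_rpow_le (p := α - 1) (by linarith) T
    rwa [show α - 1 - 1 = α - 2 by ring] at h
  let h : ℕ → ℝ := fun k => min (2 * Δmax) (2 * c * √(2 * σ ^ 2 * (α * Real.log T)) / √(k : ℝ))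
  have hh0 : ∀ k, 0 ≤ h k := fun k => le_min (by positivity) (by positivity)
  let D : ℕ → Ω → ℝ := fun t ω =>
    (B (-1) t).indicator (fun _ => Δmax) ω + (B 1 t).indicator (fun _ => 2 * Δmax) ω
  have hD0 : ∀ t ω, 0 ≤ D t ω := fun t ω => add_nonneg
    (Set.indicator_nonneg (fun _ _ => hΔ0) ω) (Set.indicator_nonneg (fun _ _ => by positivity) ω)
  have hround : ∀ t ∈ Finset.range T, ∀ ω, g t ω ≤
      ∑ i ∈ observedItems σ α O₁ O₂ φ₀ (t + 1) (R t ω), h ((R t ω).count i) +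
        (if t < N then 2 * Δmax else 0) + D t ω := by
    intro t ht ω
    by_cases htN : t < N
    · rw [if_pos htN]
      linarith [hg2 t ω, hD0 t ω, Finset.sum_nonneg
        (s := observedItems σ α O₁ O₂ φ₀ (t + 1) (R t ω)) fun i _ => hh0 ((R t ω).count i)]
    · rw [if_neg htN, add_zero]
      push Not at htN
      have h1 := round_gap_le (φ₀ := φ₀) hA hc.le hr hΔ' hO₁ hO₂ σ α (Nat.lt_succ_of_le htN) (R t ω)
      have h2 : ∑ i ∈ observedItems σ α O₁ O₂ φ₀ (t + 1) (R t ω),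
          min (2 * Δmax) (2 * c * (R t ω).width σ α (t + 1) i) ≤
          ∑ i ∈ observedItems σ α O₁ O₂ φ₀ (t + 1) (R t ω), h ((R t ω).count i) := by
        refine Finset.sum_le_sum fun i _ => min_le_min_left _ ?_
        rw [mul_div_assoc]
        exact mul_le_mul_of_nonneg_left
          (width_le hα0 (Nat.le_add_left 1 t) (Finset.mem_range.1 ht) _ _) (by positivity)
      have h3 : D t ω = (if Deviates σ α (-1) μ (t + 1) (R t ω) then Δmax else 0) +
          if Deviates σ α 1 μ (t + 1) (R t ω) then 2 * Δmax else 0 := by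
        simp [D, B, Set.indicator_apply, htN]
      rw [h3]
      linarith
  have hpoint : ∀ ω, ∑ t ∈ Finset.range T, g t ω ≤
      (N * ∑ k ∈ Finset.range (T + 1), h k + 2 * Δmax * N) + ∑ t ∈ Finset.range T, D t ω := by
    intro ω
    refine (Finset.sum_le_sum fun t ht => hround t ht ω).trans ?_
    rw [Finset.sum_add_distrib, Finset.sum_add_distrib,
      sum_observed_eq σ α O₁ O₂ φ₀ (fun s i => μ i + ε s ω i) h T]
    have h1 : ∑ i, ∑ k ∈ Finset.range ((R T ω).count i), h k ≤
        N * ∑ k ∈ Finset.range (T + 1), h k := by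
      refine (Finset.sum_le_sum fun i _ => Finset.sum_le_sum_of_subset_of_nonneg
        (Finset.range_subset_range.2 ((ulcbRecord_count_le σ α O₁ O₂ φ₀ _ T i).trans
          (Nat.le_succ T))) fun k _ _ => hh0 k).trans ?_
      simp
    have h2 : ∑ t ∈ Finset.range T, (if t < N then 2 * Δmax else 0) = 2 * Δmax * N := by
      have : (Finset.range T).filter (· < N) = Finset.range N := by
        ext t; simp; omega
      rw [← Finset.sum_filter, this, Finset.sum_const, Finset.card_range, nsmul_eq_mul, mul_comm]
    rw [h2]
    gcongr
  have hDi : ∀ t, Integrable (D t) P := fun t =>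
    ((integrable_const _).indicator (hBm _ t)).add ((integrable_const _).indicator (hBm _ t))
  have hDint : ∀ t, ∫ ω, D t ω ∂P = P.real (B (-1) t) * Δmax + P.real (B 1 t) * (2 * Δmax) := by
    intro t
    rw [integral_add ((integrable_const _).indicator (hBm _ t))
      ((integrable_const _).indicator (hBm _ t)), integral_indicator_const _ (hBm _ t),
      integral_indicator_const _ (hBm _ t), smul_eq_mul, smul_eq_mul]
  have hDsum : ∫ ω, ∑ t ∈ Finset.range T, D t ω ∂P ≤ 3 * Δmax * (N * ((α - 1) / (α - 2))) := by
    rw [integral_finsetSum _ fun t _ => hDi t]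
    simp_rw [hDint]
    rw [Finset.sum_add_distrib, ← Finset.sum_mul, ← Finset.sum_mul]
    have h1 := mul_le_mul_of_nonneg_right (hBsum (-1) (by norm_num)) hΔ0
    have h2 := mul_le_mul_of_nonneg_right (hBsum 1 (by norm_num)) (by positivity : 0 ≤ 2 * Δmax)
    linarith
  have hDsi : Integrable (fun ω => ∑ t ∈ Finset.range T, D t ω) P :=
    integrable_finsetSum _ fun t _ => hDi t
  refine (integral_mono hint ((integrable_const _).add hDsi) hpoint).trans ?_
  simp only [Pi.add_apply]
  rw [integral_add (integrable_const _) hDsi, integral_const, probReal_univ, one_smul]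
  have hfin := mul_sum_min_le (σ := σ) hΔ0 hc.le hα0 N T
  -- The initial rounds cost `2 Δmax N`, while the claim allows `6 Δmax N`.
  have : 0 ≤ Δmax * N := by positivity
  linarith
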